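/- Let $n\ge 3$ and let $\{s_t\}_{t\ge 0}$ be a binary m-sequence of order $n$, i.e. a nonzero sequence over $\mathbb F_2$ satisfying $s_{t+n}=c_{n-1}s_{t+n-1}+\dots+c_1s_{t+1}+c_0s_t$ for all $t\ge 0$, where $f(x)=x^n+c_{n-1}x^{n-1}+\dots+c_1x+c_0\in\mathbb F_2[x]$ is a primitive polynomial of degree $n$. For $1\le t\le 2^n-1$ let $G_t=(s_{i+j})_{0\le i<n,\;0\le j<t}\in\mathbb F_2^{n\times t}$, and put $r_n(t)=\operatorname{rank}_{\mathbb F_2}(G_tG_t^\top)$, with $t$ regarded modulo $2^n-1$. A class $t$ modulo $2^n-1$ is called a local minimum of $r_n$ if $r_n(t-1)=r_n(t)+1$ and $r_n(t+1)=r_n(t)+1$. Then the number of local minima of $r_n$ is $$\frac{2^{n-1}-(-1)^{n-1}}{3}.$$ Moreover, let $\alpha\in\mathbb F_{2^n}$ be a root of $f$. For $u\in\mathbb F_2[z]$ let $\widetilde u(z)=z^{\deg u}u(1/z)$, and let $U_n$ be the set of all $u\in\mathbb F_2[z]$ with $\deg u\le n-1$, $u(0)=1$ and $\gcd(u,\widetilde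 u)=1$. A canonical representation of $x\in\mathbb F_{2^n}^*$ is a pair $(k_0,u)$ with $u\in U_n$, $k_0\in\mathbb Z$, $|k_0|\le n-1-\deg u$ and $x=\alpha^{k_0}\,\widetilde u(\alpha)/u(\alpha)$. Then: for every local minimum $t$, $\alpha^t$ has exactly one canonical representation; whenever $(k_0,u)$ is a canonical representation of $\alpha^t$, $t$ is a local minimum if and only if $k_0=0$; and for every $u\in U_n$ there is exactly one local minimum $t$ modulo $2^n-1$ such that $(0,u)$ is a canonical representation of $\alpha^t$. -/

import Mathlib

open Polynomial

/-- A primitive polynomial of degree `n` over `𝔽₂`: a monic irreducible polynomial of degree `n`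
whose order (the least positive `N` with `f ∣ X ^ N - 1`) is `2 ^ n - 1`. -/
structure IsPrimitivePoly (n : ℕ) (f : (ZMod 2)[X]) : Prop where
  monic : f.Monic
  irreducible : Irreducible f
  natDegree_eq : f.natDegree = n
  order_eq : IsLeast {N : ℕ | 0 < N ∧ f ∣ X ^ N - 1} (2 ^ n - 1)

/-- `s` is a binary m-sequence of order `n` with characteristic polynomial `f`: the polynomial `f`
is primitive of degree `n`, and `s` is a nonzero solution of
`s (t + n) = c_{n-1} s (t + n - 1) + ⋯ + c_1 s (t + 1) + c_0 s t`, where `c_i = f.coeff i`. -/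
structure IsMSequence (n : ℕ) (f : (ZMod 2)[X]) (s : ℕ → ZMod 2) : Prop where
  primitive : IsPrimitivePoly n f
  ne_zero : s ≠ 0
  recurrence : ∀ t : ℕ, s (t + n) = ∑ i ∈ Finset.range n, f.coeff i * s (t + i)

/-- The observability matrix `G_t`, of size `n × t`, with entries `s (i + j)`
(`0 ≤ i < n`, `0 ≤ j < t`). -/
def observabilityMatrix (n : ℕ) (s : ℕ → ZMod 2) (t : ℕ) : Matrix (Fin n) (Fin t) (ZMod 2) :=
  Matrix.of fun i j => s ((i : ℕ) + (j : ℕ))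

/-- The rank over `𝔽₂` of the Gram matrix `G_t G_tᵀ`. -/
noncomputable def gramRank (n : ℕ) (s : ℕ → ZMod 2) (t : ℕ) : ℕ :=
  (observabilityMatrix n s t * (observabilityMatrix n s t).transpose).rank

/-- The representative of a residue class modulo `2 ^ n - 1` in `{1, …, 2 ^ n - 1}`. -/
def cyclicIndex (n : ℕ) (t : ZMod (2 ^ n - 1)) : ℕ :=
  if t.val = 0 then 2 ^ n - 1 else t.val

/-- The rank function `r_n`, with its argument regarded modulo `2 ^ n - 1`. -/
noncomputable def rankFn (n : ℕ) (s : ℕ → ZMod 2) (t : ZMod (2 ^ n - 1)) : ℕ :=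
  gramRank n s (cyclicIndex n t)

/-- The set of local minima (modulo `2 ^ n - 1`) of the rank function `r_n`. -/
def localMinima (n : ℕ) (s : ℕ → ZMod 2) : Set (ZMod (2 ^ n - 1)) :=
  {t | rankFn n s (t - 1) = rankFn n s t + 1 ∧ rankFn n s (t + 1) = rankFn n s t + 1}

/-- The polynomials `u` over `𝔽₂` with `deg u < n`, `u(0) = 1` and `gcd(u, ũ) = 1`, where
`ũ(z) = z ^ (deg u) u(1 / z)` is the reciprocal polynomial. -/
def canonicalPolys (n : ℕ) : Set (ZMod 2)[X] :=
  {u | u.natDegree < n ∧ u.coeff 0 = 1 ∧ IsCoprime u u.reverse}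

/-- `(k, u)` is a canonical representation of `x` with respect to `α`:
`u ∈ canonicalPolys n`, `|k| ≤ n - 1 - deg u` and `x = α ^ k * ũ(α) / u(α)`. -/
structure IsCanonicalRep (n : ℕ) {K : Type*} [Field K] [Algebra (ZMod 2) K] (α x : K)
    (k : ℤ) (u : (ZMod 2)[X]) : Prop where
  mem : u ∈ canonicalPolys n
  abs_le : |k| ≤ (n : ℤ) - 1 - (u.natDegree : ℤ)
  eq : x = α ^ k * (aeval α u.reverse / aeval α u)

/-! ### Reciprocal polynomials over `𝔽₂` -/

section ReciprocalPolynomials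

/-! The corank of `G_t G_tᵀ` is turned into the dimension of a space of rational approximations. A
vector `a` gives a combination `c` of shifts of `s`; let `p` and `q` be the numerators over `f` of
the generating functions of `c` and of its `t`-th shift. Always `q(α) = α^t p(α)`, and `a` lies in
the kernel exactly when also `q(α⁻¹) = α^(-t) p(α⁻¹)` (`IsMSequence.isReciprocalPair_iff`). So the
corank is the dimension of the space of such pairs of degree `< n`
(`IsMSequence.gramRank_add_finrank`).

For `n ≥ 3`, `α⁻¹` is not conjugate to `α`, so a polynomial of degree `< 2n` vanishing at both is
zero. Hence any two pairs have equal cross products, and all are multiples of one reduced fraction.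
The symmetry `α ↔ α⁻¹` forces that fraction to be `z^k ũ/u` with `u` coprime to `ũ`. Thus the rank
is `|k| + deg u` if a canonical representation exists, and `n` otherwise. Moving `t` by one moves
`k` by one, so the local minima are the classes with `k = 0`, in bijection with the admissible `u`.

To count these `u`, factor each polynomial with constant term `1` uniquely as a self-reciprocal
polynomial times one coprime to its reciprocal (`card_unitConstPolys_eq_sum`). Comparing this
convolution in degrees `d + 2` and `d` gives a two-term recurrence. -/

theorem ZMod.eq_one_of_ne_zero_two {a : ZMod 2} (h : a ≠ 0) : a = 1 := by
  revert a; decide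

theorem Polynomial.eq_of_dvd_dvd_zmod_two {p q : (ZMod 2)[X]} (h₁ : p ∣ q) (h₂ : q ∣ p) :
    p = q := by
  obtain ⟨c, hc⟩ := associated_of_dvd_dvd h₁ h₂
  obtain ⟨r, hr, hrc⟩ := Polynomial.isUnit_iff.mp c.isUnit
  have hr1 : r = 1 := ZMod.eq_one_of_ne_zero_two hr.ne_zero
  rw [← hc, ← hrc, hr1]; simp

theorem Polynomial.X_pow_mul_cancel {a b : ℕ} {v w : (ZMod 2)[X]} (hv : v.coeff 0 ≠ 0)
    (hw : w.coeff 0 ≠ 0) (h : X ^ a * v = X ^ b * w) : a = b ∧ v = w := by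
  wlog hab : a ≤ b generalizing a b v w
  · obtain ⟨h₁, h₂⟩ := this hw hv h.symm (by omega)
    exact ⟨h₁.symm, h₂.symm⟩
  obtain ⟨c, rfl⟩ := Nat.exists_eq_add_of_le hab
  rw [pow_add, mul_assoc] at h
  have h' := mul_left_cancel₀ (pow_ne_zero a X_ne_zero) h
  rcases Nat.eq_zero_or_pos c with rfl | hc
  · simpa using h'
  · exact absurd (by rw [h', mul_coeff_zero, coeff_X_pow]; simp [hc.ne]) hv

theorem Polynomial.natDegree_reverse_of_coeff_zero_ne {u : (ZMod 2)[X]} (h : u.coeff 0 ≠ 0) :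
    u.reverse.natDegree = u.natDegree := by
  rw [reverse_natDegree, natTrailingDegree_eq_zero.mpr (Or.inr h), Nat.sub_zero]

theorem Polynomial.reverse_reverse_of_coeff_zero_ne {u : (ZMod 2)[X]} (h : u.coeff 0 ≠ 0) :
    u.reverse.reverse = u := by
  rw [reverse, natDegree_reverse_of_coeff_zero_ne h, reverse, reflect_reflect]

theorem Polynomial.coeff_zero_reverse_ne_zero {u : (ZMod 2)[X]} (h : u ≠ 0) :
    u.reverse.coeff 0 ≠ 0 := by
  rwa [coeff_zero_reverse, leadingCoeff_ne_zero]

theorem Polynomial.ne_zero_of_coeff_zero_ne {u : (ZMod 2)[X]} (h : u.coeff 0 ≠ 0) : u ≠ 0 := by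
  rintro rfl; simp at h

theorem Polynomial.exists_eq_X_pow_mul {p : (ZMod 2)[X]} (hp : p ≠ 0) :
    ∃ (i : ℕ) (u : (ZMod 2)[X]), u.coeff 0 ≠ 0 ∧ p = X ^ i * u ∧
      p.natDegree = i + u.natDegree := by
  obtain ⟨u, hu, hX⟩ := exists_eq_pow_rootMultiplicity_mul_and_not_dvd p hp 0
  rw [C_0, sub_zero] at hu hX
  rw [X_dvd_iff] at hX
  refine ⟨_, u, hX, hu, ?_⟩
  conv_lhs => rw [hu]
  rw [natDegree_mul (pow_ne_zero _ X_ne_zero) (ne_zero_of_coeff_zero_ne hX), natDegree_X_pow]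

theorem Polynomial.natDegree_reflect_le_of_le {p : (ZMod 2)[X]} {N : ℕ} (h : p.natDegree ≤ N) :
    (p.reflect N).natDegree ≤ N :=
  natDegree_reflect_le.trans (max_le le_rfl h)

theorem Polynomial.aeval_reflect {K : Type*} [Field K] [Algebra (ZMod 2) K] {α : K} (hα : α ≠ 0)
    {p : (ZMod 2)[X]} {N : ℕ} (h : p.natDegree ≤ N) :
    aeval α (p.reflect N) = aeval α⁻¹ p * α ^ N := by
  let := invertibleOfNonzero hα
  have := eval₂_reflect_mul_pow (algebraMap (ZMod 2) K) α N (p.reflect N)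
    (natDegree_reflect_le_of_le h)
  rw [reflect_reflect, invOf_eq_inv] at this
  rw [aeval_def, aeval_def, this]

theorem Polynomial.reflect_eq_X_pow_mul_reverse {p : (ZMod 2)[X]} {N : ℕ} (h : p.natDegree ≤ N) :
    p.reflect N = X ^ (N - p.natDegree) * p.reverse := by
  have := reflect_mul p (1 : (ZMod 2)[X]) (F := p.natDegree) (G := N - p.natDegree) le_rfl (by simp)
  rw [mul_one, Nat.add_sub_cancel' h, reflect_one] at this
  rw [this, mul_comm, reverse]

theorem Polynomial.aeval_reverse {K : Type*} [Field K] [Algebra (ZMod 2) K] {α : K} (hα : α ≠ 0)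
    (p : (ZMod 2)[X]) : aeval α p.reverse = aeval α⁻¹ p * α ^ p.natDegree :=
  aeval_reflect hα le_rfl

theorem Polynomial.reverse_dvd {p q : (ZMod 2)[X]} (h : p ∣ q) : p.reverse ∣ q.reverse := by
  obtain ⟨c, rfl⟩ := h
  rw [reverse_mul_of_domain]; exact dvd_mul_right _ _

/-- Two coprime polynomials `u`, `v` with nonzero constant terms and `v * ṽ = u * ũ` are
reciprocal to each other. -/
theorem Polynomial.eq_reverse_of_mul_reverse_eq {u v : (ZMod 2)[X]} (hv : v.coeff 0 ≠ 0)
    (huv : IsCoprime u v) (h : v * v.reverse = u * u.reverse) :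
    v = u.reverse := by
  have h₁ : v ∣ u.reverse := huv.symm.dvd_of_dvd_mul_left (h ▸ dvd_mul_right _ _)
  have h₂ : u ∣ v.reverse := huv.dvd_of_dvd_mul_left (h ▸ dvd_mul_right _ _)
  have h₃ := reverse_dvd h₂
  rw [reverse_reverse_of_coeff_zero_ne hv] at h₃
  exact eq_of_dvd_dvd_zmod_two h₁ h₃

theorem Polynomial.exists_eq_mul_isCoprime (q : (ZMod 2)[X]) {p : (ZMod 2)[X]} (hp : p ≠ 0) :
    ∃ g Q P : (ZMod 2)[X], g ≠ 0 ∧ IsCoprime Q P ∧ q = g * Q ∧ p = g * P := by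
  obtain ⟨Q, hQ⟩ := EuclideanDomain.gcd_dvd_left q p
  obtain ⟨P, hP⟩ := EuclideanDomain.gcd_dvd_right q p
  have hg : EuclideanDomain.gcd q p ≠ 0 := fun h => hp (by rw [hP, h, zero_mul])
  have hab := EuclideanDomain.gcd_eq_gcd_ab q p
  refine ⟨_, Q, P, hg, ⟨EuclideanDomain.gcdA q p, EuclideanDomain.gcdB q p, ?_⟩, hQ, hP⟩
  apply mul_left_cancel₀ hg
  calc _ = (EuclideanDomain.gcd q p * Q) * EuclideanDomain.gcdA q p +
        (EuclideanDomain.gcd q p * P) * EuclideanDomain.gcdB q p := by ring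
    _ = _ := by rw [← hQ, ← hP, ← hab, mul_one]

end ReciprocalPolynomials

/-! ### Roots of primitive polynomials -/

section Primitive

variable {n : ℕ} {f : (ZMod 2)[X]} {K : Type*} [Field K] [Algebra (ZMod 2) K] {α : K}

theorem IsPrimitivePoly.minpoly_eq (hf : IsPrimitivePoly n f) (hα : aeval α f = 0) :
    minpoly (ZMod 2) α = f :=
  (minpoly.eq_of_irreducible_of_monic hf.irreducible hα hf.monic).symm

theorem IsPrimitivePoly.aeval_eq_zero_iff (hf : IsPrimitivePoly n f) (hα : aeval α f = 0)
    {p : (ZMod 2)[X]} : aeval α p = 0 ↔ f ∣ p := by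
  rw [← hf.minpoly_eq hα, minpoly.dvd_iff]

theorem IsPrimitivePoly.pow_eq_one_iff (hf : IsPrimitivePoly n f) (hα : aeval α f = 0) (N : ℕ) :
    α ^ N = 1 ↔ f ∣ X ^ N - 1 := by
  rw [← hf.aeval_eq_zero_iff hα]; simp [sub_eq_zero]

theorem IsPrimitivePoly.orderOf_eq (hf : IsPrimitivePoly n f) (hα : aeval α f = 0) :
    orderOf α = 2 ^ n - 1 := by
  have h := hf.order_eq
  refine le_antisymm (orderOf_le_of_pow_eq_one h.1.1 ((hf.pow_eq_one_iff hα _).2 h.1.2))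
    (h.2 ⟨?_, (hf.pow_eq_one_iff hα _).1 (pow_orderOf_eq_one α)⟩)
  exact orderOf_pos_iff.2 (isOfFinOrder_iff_pow_eq_one.2
    ⟨_, h.1.1, (hf.pow_eq_one_iff hα _).2 h.1.2⟩)

theorem IsPrimitivePoly.root_ne_zero (hf : IsPrimitivePoly n f) (hα : aeval α f = 0) : α ≠ 0 := by
  rintro rfl
  have h := hf.order_eq
  have := (hf.pow_eq_one_iff hα _).2 h.1.2
  rw [zero_pow (h.1.1 : 0 < 2 ^ n - 1).ne'] at this
  exact zero_ne_one this

theorem IsPrimitivePoly.eq_zero_of_aeval_eq_zero (hf : IsPrimitivePoly n f) (hα : aeval α f = 0)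
    {p : (ZMod 2)[X]} (hp : p.natDegree < n) (h : aeval α p = 0) : p = 0 :=
  eq_zero_of_dvd_of_natDegree_lt ((hf.aeval_eq_zero_iff hα).1 h) (hf.natDegree_eq ▸ hp)

theorem IsPrimitivePoly.eq_zero_of_aeval_inv_eq_zero (hf : IsPrimitivePoly n f)
    (hα : aeval α f = 0) {p : (ZMod 2)[X]} (hp : p.natDegree < n) (h : aeval α⁻¹ p = 0) :
    p = 0 := by
  rw [← reverse_eq_zero]
  refine hf.eq_zero_of_aeval_eq_zero hα ((reverse_natDegree_le p).trans_lt hp) ?_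
  rw [aeval_reverse (hf.root_ne_zero hα), h, zero_mul]

/-- Otherwise `α⁻¹` is a conjugate `α^(2^k)` with `k < n`, so the order `2^n - 1` of `α` is at most
`2^k + 1 ≤ 2^(n-1) + 1`, which fails for `n ≥ 3`. -/
theorem IsPrimitivePoly.aeval_inv_ne_zero (hn : 3 ≤ n) (hf : IsPrimitivePoly n f)
    (hK : Nat.card K = 2 ^ n) (hα : aeval α f = 0) : aeval α⁻¹ f ≠ 0 := by
  intro h
  have : Finite K := Nat.finite_of_card_ne_zero (by rw [hK]; positivity)
  have hmin := hf.minpoly_eq hα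
  obtain ⟨σ, hσ⟩ := minpoly.exists_algEquiv_of_root' (K := ZMod 2) (L := K) (x := α⁻¹) (y := α)
    (Algebra.IsAlgebraic.isAlgebraic α) (by rw [hmin]; exact h)
  obtain ⟨k, hk⟩ := (FiniteField.bijective_frobeniusAlgEquivOfAlgebraic_pow (ZMod 2) K).2 σ
  have hfin : Module.finrank (ZMod 2) K = n := by
    have := Module.natCard_eq_pow_finrank (K := ZMod 2) (V := K)
    rw [hK, Nat.card_zmod] at this
    exact (Nat.pow_right_injective le_rfl this).symm
  have hkn : (k : ℕ) < n := hfin ▸ k.2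
  have hpow : α ^ (2 ^ (k : ℕ)) = α⁻¹ := by
    rw [← hσ, ← hk]
    simp [AlgEquiv.coe_pow, FiniteField.coe_frobeniusAlgEquivOfAlgebraic, pow_iterate]
  have h1 : α ^ (2 ^ (k : ℕ) + 1) = 1 := by
    rw [pow_succ, hpow, inv_mul_cancel₀ (hf.root_ne_zero hα)]
  have h2 := orderOf_le_of_pow_eq_one (Nat.succ_pos _) h1
  rw [hf.orderOf_eq hα] at h2
  obtain ⟨m, rfl⟩ : ∃ m, n = m + 3 := ⟨n - 3, by omega⟩
  have h3 : 2 ^ (k : ℕ) ≤ 2 ^ (m + 2) := Nat.pow_le_pow_right (by norm_num) (by omega)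
  have h4 : 0 < 2 ^ m := by positivity
  rw [pow_add] at h2 h3
  omega

/-- The rigidity behind all uniqueness statements: dividing by `f` leaves a quotient of degree `< n`
that still vanishes at `α⁻¹`. -/
theorem IsPrimitivePoly.eq_zero_of_aeval_aeval_inv (hn : 3 ≤ n) (hf : IsPrimitivePoly n f)
    (hK : Nat.card K = 2 ^ n) (hα : aeval α f = 0) {p : (ZMod 2)[X]} (hp : p.natDegree < 2 * n)
    (h₁ : aeval α p = 0) (h₂ : aeval α⁻¹ p = 0) : p = 0 := by
  obtain ⟨q, rfl⟩ := (hf.aeval_eq_zero_iff hα).1 h₁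
  rw [map_mul] at h₂
  have hq := (mul_eq_zero.1 h₂).resolve_left (hf.aeval_inv_ne_zero hn hK hα)
  by_cases hq0 : q = 0
  · simp [hq0]
  rw [natDegree_mul hf.irreducible.ne_zero hq0, hf.natDegree_eq] at hp
  rw [hf.eq_zero_of_aeval_inv_eq_zero hα (by omega) hq, mul_zero]

end Primitive

/-! ### Reciprocal pairs and canonical representations -/

section ReciprocalPairs

variable {n : ℕ} {f : (ZMod 2)[X]} {K : Type*} [Field K] [Algebra (ZMod 2) K] {α τ : K}

/-- The pair `(q, p)` satisfies `q(α) = τ p(α)` and `q(α⁻¹) = τ⁻¹ p(α⁻¹)`. -/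
structure IsReciprocalPair (α τ : K) (q p : (ZMod 2)[X]) : Prop where
  aeval_eq : aeval α q = τ * aeval α p
  aeval_inv_eq : aeval α⁻¹ q = τ⁻¹ * aeval α⁻¹ p

/-- Two pairs for the same `τ` define the same rational function: the difference of the cross
products vanishes at `α` and `α⁻¹` and has degree `< 2n`. -/
theorem IsReciprocalPair.cross_mul_eq (hn : 3 ≤ n) (hf : IsPrimitivePoly n f)
    (hK : Nat.card K = 2 ^ n) (hα : aeval α f = 0) {q p q' p' : (ZMod 2)[X]}
    (h : IsReciprocalPair α τ q p) (h' : IsReciprocalPair α τ q' p')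
    (h₁ : q.natDegree + p'.natDegree < 2 * n) (h₂ : p.natDegree + q'.natDegree < 2 * n) :
    q * p' = p * q' := by
  rw [← sub_eq_zero]
  refine hf.eq_zero_of_aeval_aeval_inv hn hK hα ?_ ?_ ?_
  · refine (natDegree_sub_le _ _).trans_lt (max_lt ?_ ?_)
    · exact natDegree_mul_le.trans_lt h₁
    · exact natDegree_mul_le.trans_lt h₂
  · rw [map_sub, map_mul, map_mul, h.aeval_eq, h'.aeval_eq]; ring
  · rw [map_sub, map_mul, map_mul, h.aeval_inv_eq, h'.aeval_inv_eq]; ring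

/-- At `α` and at `α⁻¹` the factors `τ` and `τ⁻¹` cancel in the product of the two values.
Reflecting at `n - 1` keeps the degree at most `2n - 2`. -/
theorem IsReciprocalPair.mul_reflect_eq (hn : 3 ≤ n) (hf : IsPrimitivePoly n f)
    (hK : Nat.card K = 2 ^ n) (hα : aeval α f = 0) (hτ : τ ≠ 0) {q p : (ZMod 2)[X]}
    (h : IsReciprocalPair α τ q p) (hq : q.natDegree < n) (hp : p.natDegree < n) :
    q * q.reflect (n - 1) = p * p.reflect (n - 1) := by
  have hα0 := hf.root_ne_zero hα
  have hq' : q.natDegree ≤ n - 1 := by omega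
  have hp' : p.natDegree ≤ n - 1 := by omega
  have hqr := natDegree_reflect_le_of_le hq'
  have hpr := natDegree_reflect_le_of_le hp'
  have inv (r : (ZMod 2)[X]) (hr : r.natDegree ≤ n - 1) :
      aeval α⁻¹ (r.reflect (n - 1)) = aeval α r * α⁻¹ ^ (n - 1) := by
    rw [aeval_reflect (inv_ne_zero hα0) hr, inv_inv]
  rw [← sub_eq_zero]
  refine hf.eq_zero_of_aeval_aeval_inv hn hK hα ?_ ?_ ?_
  · refine (natDegree_sub_le _ _).trans_lt (max_lt ?_ ?_) <;>
      exact natDegree_mul_le.trans_lt (by omega)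
  · rw [map_sub, map_mul, map_mul, aeval_reflect hα0 hq', aeval_reflect hα0 hp', h.aeval_eq,
      h.aeval_inv_eq]
    field_simp
    ring
  · rw [map_sub, map_mul, map_mul, inv q hq', inv p hp', h.aeval_eq, h.aeval_inv_eq]
    field_simp
    ring

/-- The numerator of the rational function `z ^ k * ũ(z) / u(z)`. -/
noncomputable def repNum (k : ℤ) (u : (ZMod 2)[X]) : (ZMod 2)[X] := X ^ k.toNat * u.reverse

/-- The denominator of the rational function `z ^ k * ũ(z) / u(z)`. -/
noncomputable def repDen (k : ℤ) (u : (ZMod 2)[X]) : (ZMod 2)[X] := X ^ (-k).toNat * u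

theorem coeff_zero_ne_of_mem_canonicalPolys {u : (ZMod 2)[X]} (hu : u ∈ canonicalPolys n) :
    u.coeff 0 ≠ 0 := by
  rw [hu.2.1]; exact one_ne_zero

theorem natDegree_repNum {k : ℤ} {u : (ZMod 2)[X]} (hu : u.coeff 0 ≠ 0) :
    (repNum k u).natDegree = k.toNat + u.natDegree := by
  rw [repNum, natDegree_mul (pow_ne_zero _ X_ne_zero)
    (reverse_eq_zero.not.2 (ne_zero_of_coeff_zero_ne hu)), natDegree_X_pow,
    natDegree_reverse_of_coeff_zero_ne hu]

theorem natDegree_repDen {k : ℤ} {u : (ZMod 2)[X]} (hu : u.coeff 0 ≠ 0) :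
    (repDen k u).natDegree = (-k).toNat + u.natDegree := by
  rw [repDen, natDegree_mul (pow_ne_zero _ X_ne_zero) (ne_zero_of_coeff_zero_ne hu),
    natDegree_X_pow]

theorem isCoprime_X_of_coeff_zero_ne {u : (ZMod 2)[X]} (hu : u.coeff 0 ≠ 0) : IsCoprime X u :=
  irreducible_X.coprime_iff_not_dvd.2 (by rwa [X_dvd_iff])

theorem isCoprime_repNum_repDen {k : ℤ} {u : (ZMod 2)[X]} (hu : u ∈ canonicalPolys n) :
    IsCoprime (repNum k u) (repDen k u) := by
  have h0 := coeff_zero_ne_of_mem_canonicalPolys hu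
  have h1 := isCoprime_X_of_coeff_zero_ne h0
  have h2 := isCoprime_X_of_coeff_zero_ne (coeff_zero_reverse_ne_zero (ne_zero_of_coeff_zero_ne h0))
  rw [repNum, repDen]
  rcases le_total 0 k with hk | hk
  · rw [Int.toNat_of_nonpos (z := -k) (by omega), pow_zero, one_mul]
    exact (h1.pow_left).mul_left hu.2.2.symm
  · rw [Int.toNat_of_nonpos hk, pow_zero, one_mul]
    exact (h2.symm.pow_right).mul_right hu.2.2.symm

theorem IsPrimitivePoly.aeval_ne_zero_of_mem (hf : IsPrimitivePoly n f) (hα : aeval α f = 0)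
    {u : (ZMod 2)[X]} (hu : u ∈ canonicalPolys n) : aeval α u ≠ 0 := fun h =>
  ne_zero_of_coeff_zero_ne (coeff_zero_ne_of_mem_canonicalPolys hu)
    (hf.eq_zero_of_aeval_eq_zero hα hu.1 h)

theorem reverse_mem_canonicalPolys {u : (ZMod 2)[X]} (hu : u ∈ canonicalPolys n) :
    u.reverse ∈ canonicalPolys n := by
  have h0 := coeff_zero_ne_of_mem_canonicalPolys hu
  refine ⟨(natDegree_reverse_of_coeff_zero_ne h0).trans_lt hu.1, ?_, ?_⟩
  · exact ZMod.eq_one_of_ne_zero_two (coeff_zero_reverse_ne_zero (ne_zero_of_coeff_zero_ne h0))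
  · rw [reverse_reverse_of_coeff_zero_ne h0]; exact hu.2.2.symm

/-- The substitution `z ↦ 1/z` inverts `z^k ũ(z)/u(z)`, so the condition at `α⁻¹` follows from the
one at `α`. -/
theorem isReciprocalPair_repNum_repDen (hf : IsPrimitivePoly n f) (hα : aeval α f = 0)
    {k : ℤ} {u : (ZMod 2)[X]} (hu : u ∈ canonicalPolys n)
    (hτ : τ = α ^ k * (aeval α u.reverse / aeval α u)) :
    IsReciprocalPair α τ (repNum k u) (repDen k u) := by
  have h0 := hf.root_ne_zero hα
  have hu0 := coeff_zero_ne_of_mem_canonicalPolys hu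
  have h1 := hf.aeval_ne_zero_of_mem hα hu
  have h2 := hf.aeval_ne_zero_of_mem hα (reverse_mem_canonicalPolys hu)
  have h3 := aeval_reverse h0 u
  have h4 := aeval_reverse h0 u.reverse
  rw [reverse_reverse_of_coeff_zero_ne hu0, natDegree_reverse_of_coeff_zero_ne hu0] at h4
  have hk : α ^ k.toNat = α ^ k * α ^ (-k).toNat := by
    rw [← zpow_natCast, ← zpow_natCast, ← zpow_add₀ h0]; congr 1; omega
  have hk0 : α ^ k ≠ 0 := zpow_ne_zero _ h0
  have hd : α ^ u.natDegree ≠ 0 := pow_ne_zero _ h0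
  have hm : α ^ (-k).toNat ≠ 0 := pow_ne_zero _ h0
  subst hτ
  constructor
  · rw [repNum, repDen]
    simp only [map_mul, map_pow, aeval_X]
    rw [hk]
    field_simp
  · rw [repNum, repDen]
    simp only [map_mul, map_pow, aeval_X, inv_pow]
    rw [eq_div_of_mul_eq hd h3.symm, eq_div_of_mul_eq hd h4.symm, hk]
    field_simp

/-- The bound is on the sum of the two sizes, not on each: one of the representations may have size
exactly `n`, as is needed at the edge in `IsMSequence.gramRank_eq_of_zpow`. -/
theorem canonicalRep_unique (hn : 3 ≤ n) (hf : IsPrimitivePoly n f)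
    (hK : Nat.card K = 2 ^ n) (hα : aeval α f = 0) {k k' : ℤ} {u u' : (ZMod 2)[X]}
    (hu : u ∈ canonicalPolys n) (hu' : u' ∈ canonicalPolys n)
    (h : τ = α ^ k * (aeval α u.reverse / aeval α u))
    (h' : τ = α ^ k' * (aeval α u'.reverse / aeval α u'))
    (hlt : k.natAbs + u.natDegree + (k'.natAbs + u'.natDegree) < 2 * n) : k = k' ∧ u = u' := by
  have h0 := coeff_zero_ne_of_mem_canonicalPolys hu
  have h0' := coeff_zero_ne_of_mem_canonicalPolys hu'
  have hr := coeff_zero_ne_of_mem_canonicalPolys (reverse_mem_canonicalPolys hu)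
  have hr' := coeff_zero_ne_of_mem_canonicalPolys (reverse_mem_canonicalPolys hu')
  have key := (isReciprocalPair_repNum_repDen hf hα hu h).cross_mul_eq hn hf hK hα
    (isReciprocalPair_repNum_repDen hf hα hu' h')
    (by rw [natDegree_repNum h0, natDegree_repDen h0']; omega)
    (by rw [natDegree_repDen h0, natDegree_repNum h0']; omega)
  have key' : X ^ (k.toNat + (-k').toNat) * (u.reverse * u') =
      X ^ ((-k).toNat + k'.toNat) * (u * u'.reverse) := by
    rw [repNum, repDen, repNum, repDen] at key
    rw [pow_add, pow_add]
    linear_combination key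
  obtain ⟨e, e'⟩ := X_pow_mul_cancel (by rw [mul_coeff_zero]; exact mul_ne_zero hr h0')
    (by rw [mul_coeff_zero]; exact mul_ne_zero h0 hr') key'
  refine ⟨by omega, eq_of_dvd_dvd_zmod_two ?_ ?_⟩
  · exact hu.2.2.dvd_of_dvd_mul_left (e' ▸ dvd_mul_right _ _)
  · refine hu'.2.2.dvd_of_dvd_mul_right ?_
    rw [← e']; exact dvd_mul_left _ _

/-- Reduce `q/p` to lowest terms and strip the powers of `z`, leaving coprime `v` and `u`. The
reflection identity becomes `v ṽ = u ũ`, hence `v = ũ`; `k` is the difference of the stripped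
exponents. -/
theorem exists_canonicalRep_of_isReciprocalPair (hn : 3 ≤ n) (hf : IsPrimitivePoly n f)
    (hK : Nat.card K = 2 ^ n) (hα : aeval α f = 0) (hτ : τ ≠ 0) {q p : (ZMod 2)[X]}
    (h : IsReciprocalPair α τ q p) (hq : q.natDegree < n) (hp : p.natDegree < n) (hp0 : p ≠ 0) :
    ∃ (k : ℤ) (u : (ZMod 2)[X]), IsCanonicalRep n α τ k u := by
  have hα0 := hf.root_ne_zero hα
  have hpα : aeval α p ≠ 0 := fun h' => hp0 (hf.eq_zero_of_aeval_eq_zero hα hp h')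
  have hqα : aeval α q ≠ 0 := by rw [h.aeval_eq]; exact mul_ne_zero hτ hpα
  have hq0 : q ≠ 0 := by rintro rfl; simp at hqα
  have key := h.mul_reflect_eq hn hf hK hα hτ hq hp
  rw [reflect_eq_X_pow_mul_reverse (by omega), reflect_eq_X_pow_mul_reverse (by omega)] at key
  obtain ⟨g, Q, P, hg0, hcop, rfl, rfl⟩ := exists_eq_mul_isCoprime q hp0
  have hQ0 := right_ne_zero_of_mul hq0
  have hP0 := right_ne_zero_of_mul hp0
  obtain ⟨i, v, hv, hQ, hQd⟩ := exists_eq_X_pow_mul hQ0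
  obtain ⟨j, u, hu, hP, hPd⟩ := exists_eq_X_pow_mul hP0
  rw [natDegree_mul hg0 hQ0] at hq key
  rw [natDegree_mul hg0 hP0] at hp key
  rw [reverse_mul_of_domain, reverse_mul_of_domain] at key
  have hQr : Q.reverse = v.reverse := by rw [hQ, reverse_X_pow_mul]
  have hPr : P.reverse = u.reverse := by rw [hP, reverse_X_pow_mul]
  have key' : X ^ (i + (n - 1 - (g.natDegree + Q.natDegree))) * (v * v.reverse) =
      X ^ (j + (n - 1 - (g.natDegree + P.natDegree))) * (u * u.reverse) := by
    -- The common factor contributes `g` times its reciprocal to both sides of `key`.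
    have hgr : g.reverse ≠ 0 := reverse_eq_zero.not.2 hg0
    apply mul_left_cancel₀ (mul_ne_zero hg0 hgr)
    rw [hQr, hPr] at key
    generalize n - 1 - (g.natDegree + Q.natDegree) = a at *
    generalize n - 1 - (g.natDegree + P.natDegree) = b at *
    rw [pow_add, pow_add]
    subst hQ hP
    linear_combination key
  have hrev (w : (ZMod 2)[X]) (hw : w.coeff 0 ≠ 0) : (w * w.reverse).coeff 0 ≠ 0 := by
    rw [mul_coeff_zero]
    exact mul_ne_zero hw (coeff_zero_reverse_ne_zero (ne_zero_of_coeff_zero_ne hw))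
  obtain ⟨-, e⟩ := X_pow_mul_cancel (hrev v hv) (hrev u hu) key'
  rw [hQ, hP] at hcop
  have hcop' : IsCoprime u v :=
    (hcop.of_mul_left_right.of_mul_right_right).symm
  have hvu := eq_reverse_of_mul_reverse_eq hv hcop' e
  subst hvu
  have hd := natDegree_reverse_of_coeff_zero_ne hu
  have hum : u ∈ canonicalPolys n := ⟨by omega, ZMod.eq_one_of_ne_zero_two hu, hcop'⟩
  refine ⟨(i : ℤ) - j, u, hum, ?_, ?_⟩
  · rw [abs_le]; omega
  · have h1 := hf.aeval_ne_zero_of_mem hα hum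
    have h2 := h.aeval_eq
    rw [map_mul] at hpα
    have hgα := left_ne_zero_of_mul hpα
    rw [hQ, hP] at h2
    simp only [map_mul, map_pow, aeval_X] at h2
    have hj : α ^ j ≠ 0 := pow_ne_zero _ hα0
    rw [zpow_sub₀ hα0, zpow_natCast, zpow_natCast]
    field_simp
    apply mul_left_cancel₀ hgα
    linear_combination -h2

end ReciprocalPairs

/-! ### Linear recurrences and numerators of generating functions -/

section LinearRecurrences

variable {n : ℕ} {f : (ZMod 2)[X]}

/-- The left shift of sequences. -/
def seqShift : Module.End (ZMod 2) (ℕ → ZMod 2) := LinearMap.funLeft (ZMod 2) (ZMod 2) Nat.succ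

theorem seqShift_pow_apply (t : ℕ) (c : ℕ → ZMod 2) (k : ℕ) : (seqShift ^ t) c k = c (k + t) := by
  induction t generalizing c k with
  | zero => rfl
  | succ t ih =>
    rw [pow_succ, Module.End.mul_apply, ih]
    rfl

theorem aeval_seqShift_sum {ι : Type*} (S : Finset ι) (e : ι → ℕ) (b : ι → ZMod 2)
    (c : ℕ → ZMod 2) (k : ℕ) :
    aeval seqShift (∑ i ∈ S, monomial (e i) (b i)) c k = ∑ i ∈ S, b i * c (k + e i) := by
  simp only [map_sum, LinearMap.sum_apply, Finset.sum_apply, aeval_monomial, Module.End.mul_apply,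
    Module.algebraMap_end_apply, Pi.smul_apply, seqShift_pow_apply, smul_eq_mul]

theorem aeval_seqShift_apply (w : (ZMod 2)[X]) (c : ℕ → ZMod 2) (k : ℕ) :
    aeval seqShift w c k = ∑ j ∈ Finset.range (w.natDegree + 1), w.coeff j * c (k + j) := by
  conv_lhs => rw [w.as_sum_range]
  exact aeval_seqShift_sum _ _ _ _ _

theorem IsMSequence.aeval_seqShift_eq_zero {s : ℕ → ZMod 2} (hs : IsMSequence n f s) :
    aeval seqShift f s = 0 := by
  ext k
  have h1 : f.coeff n = 1 := by
    rw [← hs.primitive.natDegree_eq]; exact hs.primitive.monic.coeff_natDegree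
  rw [aeval_seqShift_apply, hs.primitive.natDegree_eq, Finset.sum_range_succ, ← hs.recurrence, h1,
    one_mul, CharTwo.add_self_eq_zero, Pi.zero_apply]

/-- The annihilator of `s` is the ideal of `f`: if `f ∤ w`, irreducibility gives a Bézout relation,
and `w` killing `s` would force `s = 0`. -/
theorem IsMSequence.aeval_seqShift_eq_zero_iff {s : ℕ → ZMod 2} (hs : IsMSequence n f s)
    {w : (ZMod 2)[X]} : aeval seqShift w s = 0 ↔ f ∣ w := by
  constructor
  · intro h
    by_contra hw
    obtain ⟨a, b, hab⟩ := hs.primitive.irreducible.coprime_iff_not_dvd.2 hw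
    apply hs.ne_zero
    have := congrArg (fun v => aeval seqShift v s) hab
    simpa [hs.aeval_seqShift_eq_zero, h] using this.symm
  · rintro ⟨c, rfl⟩
    rw [mul_comm, map_mul, Module.End.mul_apply, hs.aeval_seqShift_eq_zero, map_zero]

theorem Polynomial.coeff_divX_iterate (p : (ZMod 2)[X]) (j i : ℕ) :
    (divX^[j] p).coeff i = p.coeff (i + j) := by
  induction j generalizing i with
  | zero => rfl
  | succ j ih => rw [Function.iterate_succ_apply', coeff_divX, ih]; congr 1; omega

/-- The polynomial part of `f(z) * ∑ c_j z ^ (-j-1)`: the numerator of the generating function of a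
solution `c` of the recurrence with characteristic polynomial `f`. -/
noncomputable def seqNum (f : (ZMod 2)[X]) : (ℕ → ZMod 2) →ₗ[ZMod 2] (ZMod 2)[X] where
  toFun c := ∑ j ∈ Finset.range f.natDegree, C (c j) * divX^[j + 1] f
  map_add' c d := by simp [add_mul, Finset.sum_add_distrib]
  map_smul' a c := by simp [Finset.smul_sum, smul_eq_C_mul, mul_assoc]

theorem seqNum_apply (f : (ZMod 2)[X]) (c : ℕ → ZMod 2) :
    seqNum f c = ∑ j ∈ Finset.range f.natDegree, C (c j) * divX^[j + 1] f := rfl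

theorem coeff_seqNum_eq_zero (c : ℕ → ZMod 2) {m : ℕ} (hm : f.natDegree ≤ m) :
    (seqNum f c).coeff m = 0 := by
  rw [seqNum_apply, finsetSum_coeff]
  refine Finset.sum_eq_zero fun j _ => ?_
  rw [coeff_C_mul, coeff_divX_iterate, coeff_eq_zero_of_natDegree_lt (by omega), mul_zero]

theorem seqNum_mem_degreeLT (c : ℕ → ZMod 2) : seqNum f c ∈ degreeLT (ZMod 2) f.natDegree := by
  rw [mem_degreeLT, degree_lt_iff_coeff_zero]
  exact fun m hm => coeff_seqNum_eq_zero c hm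

/-- Multiplying `∑ c_j z^(-j-1)` by `z` splits off `c_0` and leaves the series of the shifted
sequence; this is that identity times `f`. -/
theorem X_mul_seqNum (hf : f.Monic) {c : ℕ → ZMod 2} (hc : aeval seqShift f c = 0) :
    X * seqNum f c = C (c 0) * f + seqNum f (seqShift c) := by
  have hstep (j : ℕ) : X * divX^[j + 1] f = divX^[j] f + C (f.coeff j) := by
    have := divX_mul_X_add (divX^[j] f)
    rw [coeff_divX_iterate, zero_add] at this
    rw [Function.iterate_succ_apply', ← CharTwo.sub_eq_add, eq_sub_iff_add_eq, mul_comm]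
    exact this
  -- Since `f` is monic, the constant produced by the recurrence is the missing top summand, so the
  -- sum extends to `j = deg f` and can be reindexed.
  have htop : divX^[f.natDegree] f = 1 := by
    ext i
    rw [coeff_divX_iterate, coeff_one]
    rcases Nat.eq_zero_or_pos i with rfl | hi
    · simpa using hf.coeff_natDegree
    · rw [coeff_eq_zero_of_natDegree_lt (by omega), if_neg hi.ne']
  have hrec : c f.natDegree = ∑ j ∈ Finset.range f.natDegree, f.coeff j * c j := by
    have := congrFun hc 0
    rw [aeval_seqShift_apply, Finset.sum_range_succ, hf.coeff_natDegree, one_mul] at this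
    simp only [zero_add, Pi.zero_apply] at this
    exact (CharTwo.add_eq_zero.1 this).symm
  have h1 : X * seqNum f c = ∑ j ∈ Finset.range f.natDegree, C (c j) * divX^[j] f +
      C (c f.natDegree) * divX^[f.natDegree] f := by
    rw [htop, mul_one, hrec, map_sum, seqNum_apply, Finset.mul_sum, ← Finset.sum_add_distrib]
    refine Finset.sum_congr rfl fun j _ => ?_
    rw [mul_left_comm, hstep, map_mul]; ring
  rw [h1, ← Finset.sum_range_succ (fun j => C (c j) * divX^[j] f), Finset.sum_range_succ', add_comm]
  rfl

theorem aeval_seqShift_pow_apply {c : ℕ → ZMod 2} (hc : aeval seqShift f c = 0) (t : ℕ) :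
    aeval seqShift f ((seqShift ^ t) c) = 0 := by
  have : aeval seqShift f * seqShift ^ t = seqShift ^ t * aeval seqShift f := by
    have := congrArg (aeval seqShift) (mul_comm f (X ^ t))
    simpa using this
  rw [← Module.End.mul_apply, this, Module.End.mul_apply, hc, map_zero]

/-- If the numerator vanishes, the coefficient of degree `deg f` in `X_mul_seqNum` gives `c 0 = 0`,
and the shifted numerator vanishes too; iterate. -/
theorem eq_zero_of_seqNum_eq_zero (hf : f.Monic) {c : ℕ → ZMod 2} (hc : aeval seqShift f c = 0)
    (h : seqNum f c = 0) : c = 0 := by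
  have step (d : ℕ → ZMod 2) (hd : aeval seqShift f d = 0) (h : seqNum f d = 0) :
      d 0 = 0 ∧ seqNum f (seqShift d) = 0 := by
    have h1 := X_mul_seqNum hf hd
    rw [h, mul_zero] at h1
    have h2 := congrArg (fun p => p.coeff f.natDegree) h1
    simp only [coeff_zero, coeff_add, coeff_C_mul, hf.coeff_natDegree, mul_one,
      coeff_seqNum_eq_zero _ le_rfl, add_zero] at h2
    rw [← h2, map_zero, zero_mul, zero_add] at h1
    exact ⟨h2.symm, h1.symm⟩
  have all (k : ℕ) : seqNum f ((seqShift ^ k) c) = 0 := by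
    induction k with
    | zero => exact h
    | succ k ih =>
      rw [pow_succ', Module.End.mul_apply]
      exact (step _ (aeval_seqShift_pow_apply hc k) ih).2
  ext k
  have := (step _ (aeval_seqShift_pow_apply hc k) (all k)).1
  rwa [seqShift_pow_apply, zero_add] at this

/-- `X_mul_seqNum` iterated `t` times. At `x = α` the last term disappears; at `x = α⁻¹` it is a
nonzero multiple of the truncation of `c` evaluated at `α`. -/
theorem aeval_seqNum (hf : f.Monic) {c : ℕ → ZMod 2} (hc : aeval seqShift f c = 0)
    {K : Type*} [Field K] [Algebra (ZMod 2) K] {x : K} (hx : x ≠ 0) (t : ℕ) :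
    aeval x (seqNum f c) = x⁻¹ ^ t * aeval x (seqNum f ((seqShift ^ t) c)) +
      aeval x f * x⁻¹ * aeval x⁻¹ (∑ j ∈ Finset.range t, monomial j (c j)) := by
  induction t with
  | zero => simp
  | succ t ih =>
    have h := congrArg (aeval x) (X_mul_seqNum hf (aeval_seqShift_pow_apply hc t))
    simp only [map_mul, map_add, aeval_X, aeval_C, seqShift_pow_apply, zero_add] at h
    rw [← Module.End.mul_apply, ← pow_succ'] at h
    have hy := inv_mul_cancel₀ hx
    rw [ih, Finset.sum_range_succ, map_add, aeval_monomial, pow_succ]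
    generalize x⁻¹ = y at *
    linear_combination y ^ t * y * h - y ^ t * aeval x (seqNum f ((seqShift ^ t) c)) * hy

end LinearRecurrences

theorem Polynomial.mem_degreeLT_iff_natDegree_lt {n : ℕ} (hn : 0 < n) {p : (ZMod 2)[X]} :
    p ∈ degreeLT (ZMod 2) n ↔ p.natDegree < n := by
  rw [mem_degreeLT]
  by_cases hp : p = 0
  · simp [hp, hn]
  · rw [natDegree_lt_iff_degree_lt hp]

/-! ### The kernel of the Gram matrix as a space of reciprocal pairs -/

section GramKernel

variable {n : ℕ} {f : (ZMod 2)[X]} {s : ℕ → ZMod 2} {K : Type*} [Field K] [Algebra (ZMod 2) K]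
  {α τ : K}

/-- The space of pairs of polynomials `(q, p)` of degree less than `n` with `q(α) = τ p(α)` and
`q(α⁻¹) = τ⁻¹ p(α⁻¹)`. -/
noncomputable def reciprocalPairs (n : ℕ) (α τ : K) :
    Submodule (ZMod 2) ((ZMod 2)[X] × (ZMod 2)[X]) where
  carrier := {z | z.1 ∈ degreeLT (ZMod 2) n ∧ z.2 ∈ degreeLT (ZMod 2) n ∧
    IsReciprocalPair α τ z.1 z.2}
  zero_mem' := ⟨zero_mem _, zero_mem _, by simp, by simp⟩
  add_mem' := by
    rintro z w ⟨h1, h2, h3, h4⟩ ⟨h1', h2', h3', h4'⟩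
    refine ⟨add_mem h1 h1', add_mem h2 h2', ?_, ?_⟩
    · rw [Prod.fst_add, Prod.snd_add, map_add, map_add, h3, h3', mul_add]
    · rw [Prod.fst_add, Prod.snd_add, map_add, map_add, h4, h4', mul_add]
  smul_mem' := by
    rintro a z ⟨h1, h2, h3, h4⟩
    refine ⟨Submodule.smul_mem _ _ h1, Submodule.smul_mem _ _ h2, ?_, ?_⟩
    · rw [Prod.smul_fst, Prod.smul_snd, map_smul, map_smul, h3, mul_smul_comm]
    · rw [Prod.smul_fst, Prod.smul_snd, map_smul, map_smul, h4, mul_smul_comm]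

theorem mem_reciprocalPairs {z : (ZMod 2)[X] × (ZMod 2)[X]} :
    z ∈ reciprocalPairs n α τ ↔ z.1 ∈ degreeLT (ZMod 2) n ∧ z.2 ∈ degreeLT (ZMod 2) n ∧
      IsReciprocalPair α τ z.1 z.2 := Iff.rfl

/-- The linear combination of the first `n` shifts of `s` with coefficients `a`. -/
noncomputable def shiftComb (n : ℕ) (s : ℕ → ZMod 2) :
    (Fin n → ZMod 2) →ₗ[ZMod 2] (ℕ → ZMod 2) :=
  LinearMap.applyₗ s ∘ₗ (aeval seqShift).toLinearMap ∘ₗ (degreeLT (ZMod 2) n).subtype ∘ₗ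
    (degreeLTEquiv (ZMod 2) n).symm.toLinearMap

theorem shiftComb_eq (a : Fin n → ZMod 2) :
    shiftComb n s a = aeval seqShift ((degreeLTEquiv (ZMod 2) n).symm a : (ZMod 2)[X]) s := rfl

theorem shiftComb_apply (a : Fin n → ZMod 2) (k : ℕ) :
    shiftComb n s a k = ∑ i : Fin n, a i * s (k + i) :=
  aeval_seqShift_sum Finset.univ (fun i : Fin n => (i : ℕ)) a s k

theorem IsMSequence.aeval_shiftComb (hs : IsMSequence n f s) (a : Fin n → ZMod 2) :
    aeval seqShift f (shiftComb n s a) = 0 := by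
  rw [shiftComb_eq, ← Module.End.mul_apply, ← map_mul, hs.aeval_seqShift_eq_zero_iff]
  exact dvd_mul_right _ _

theorem IsMSequence.shiftComb_injective (hs : IsMSequence n f s) :
    Function.Injective (shiftComb n s) := by
  rw [← LinearMap.ker_eq_bot, LinearMap.ker_eq_bot']
  intro a ha
  rw [shiftComb_eq, hs.aeval_seqShift_eq_zero_iff] at ha
  have h := eq_zero_of_dvd_of_degree_lt ha (by
    rw [degree_eq_natDegree hs.primitive.irreducible.ne_zero, hs.primitive.natDegree_eq]
    exact mem_degreeLT.1 ((degreeLTEquiv (ZMod 2) n).symm a).2)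
  simpa using h

theorem IsMSequence.seqNum_shiftComb_injective (hs : IsMSequence n f s) :
    Function.Injective (seqNum f ∘ₗ shiftComb n s) := by
  rw [← LinearMap.ker_eq_bot, LinearMap.ker_eq_bot']
  intro a ha
  apply hs.shiftComb_injective
  rw [map_zero]
  exact eq_zero_of_seqNum_eq_zero hs.primitive.monic (hs.aeval_shiftComb a) ha

theorem IsMSequence.exists_seqNum_shiftComb (hs : IsMSequence n f s) {p : (ZMod 2)[X]}
    (hp : p ∈ degreeLT (ZMod 2) n) : ∃ a, seqNum f (shiftComb n s a) = p := by
  let g : (Fin n → ZMod 2) →ₗ[ZMod 2] degreeLT (ZMod 2) n :=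
    (seqNum f ∘ₗ shiftComb n s).codRestrict _ fun a => by
      have := seqNum_mem_degreeLT (f := f) (shiftComb n s a)
      rwa [hs.primitive.natDegree_eq] at this
  have hg : Function.Injective g := fun a b h =>
    hs.seqNum_shiftComb_injective (congrArg Subtype.val h)
  have hinj : Function.Injective (g ∘ₗ (degreeLTEquiv (ZMod 2) n).toLinearMap) :=
    hg.comp (degreeLTEquiv (ZMod 2) n).injective
  have : Module.Finite (ZMod 2) (degreeLT (ZMod 2) n) :=
    Module.Finite.equiv (degreeLTEquiv (ZMod 2) n).symm
  have hsurj := LinearMap.injective_iff_surjective.1 hinj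
  obtain ⟨b, hb⟩ := hsurj ⟨p, hp⟩
  exact ⟨_, congrArg Subtype.val hb⟩

/-- A solution is determined by its first `n` terms, the only ones entering its numerator. -/
theorem IsMSequence.aeval_eq_zero_iff_forall_lt (hs : IsMSequence n f s) {w : (ZMod 2)[X]} :
    (∀ i < n, aeval seqShift w s i = 0) ↔ f ∣ w := by
  rw [← hs.aeval_seqShift_eq_zero_iff]
  refine ⟨fun h => ?_, fun h i _ => congrFun h i⟩
  apply eq_zero_of_seqNum_eq_zero hs.primitive.monic
  · rw [← Module.End.mul_apply, ← map_mul, hs.aeval_seqShift_eq_zero_iff]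
    exact dvd_mul_right _ _
  · rw [seqNum_apply, hs.primitive.natDegree_eq]
    refine Finset.sum_eq_zero fun j hj => ?_
    rw [h j (Finset.mem_range.1 hj), C_0, zero_mul]

/-- `G_tᵀ a` lists the first `t` terms of `shiftComb n s a`. Applying `G_t` lists the first `n`
terms of the truncation polynomial, in the shift, acting on `s`. -/
theorem IsMSequence.mem_ker_gram_iff (hs : IsMSequence n f s) (t : ℕ) (a : Fin n → ZMod 2) :
    a ∈ LinearMap.ker
      (observabilityMatrix n s t * (observabilityMatrix n s t).transpose).mulVecLin ↔
      f ∣ ∑ j ∈ Finset.range t, monomial j (shiftComb n s a j) := by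
  rw [← hs.aeval_eq_zero_iff_forall_lt, LinearMap.mem_ker, Matrix.mulVecLin_apply,
    ← Matrix.mulVec_mulVec]
  have h1 : (observabilityMatrix n s t).transpose.mulVec a = fun j : Fin t => shiftComb n s a j := by
    ext j
    rw [shiftComb_apply]
    simp only [Matrix.mulVec, dotProduct, observabilityMatrix, Matrix.transpose_apply,
      Matrix.of_apply, mul_comm, add_comm]
  have h2 (i : Fin n) : (observabilityMatrix n s t).mulVec (fun j : Fin t => shiftComb n s a j) i =
      aeval seqShift (∑ j ∈ Finset.range t, monomial j (shiftComb n s a j)) s i := by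
    rw [aeval_seqShift_sum (Finset.range t) (fun j => j),
      Finset.sum_range (fun j => shiftComb n s a j * s ((i : ℕ) + j))]
    simp only [Matrix.mulVec, dotProduct, observabilityMatrix, Matrix.of_apply, mul_comm]
  rw [h1]
  constructor
  · intro h i hi
    rw [← h2 ⟨i, hi⟩, h]; rfl
  · intro h
    ext i
    rw [h2]; exact h i i.2

theorem IsMSequence.isReciprocalPair_iff (hn : 3 ≤ n) (hs : IsMSequence n f s)
    (hK : Nat.card K = 2 ^ n) (hα : aeval α f = 0) (t : ℕ) (a : Fin n → ZMod 2) :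
    IsReciprocalPair α (α ^ t) (seqNum f ((seqShift ^ t) (shiftComb n s a)))
      (seqNum f (shiftComb n s a)) ↔
      f ∣ ∑ j ∈ Finset.range t, monomial j (shiftComb n s a j) := by
  have h0 := hs.primitive.root_ne_zero hα
  have hf := hs.primitive.monic
  have hc := hs.aeval_shiftComb a
  have h1 := aeval_seqNum hf hc h0 t
  have h2 := aeval_seqNum hf hc (inv_ne_zero h0) t
  rw [hα, zero_mul, zero_mul, add_zero] at h1
  rw [inv_inv] at h2
  have h3 := hs.primitive.aeval_inv_ne_zero hn hK hα
  rw [← hs.primitive.aeval_eq_zero_iff hα]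
  have ht : α ^ t ≠ 0 := pow_ne_zero _ h0
  constructor
  · rintro ⟨-, h⟩
    rw [h, mul_inv_cancel_left₀ ht, left_eq_add] at h2
    exact (mul_eq_zero.1 h2).resolve_left (mul_ne_zero h3 h0)
  · intro h
    rw [h, mul_zero, add_zero] at h2
    constructor
    · rw [h1]; simp [ht]
    · rw [h2, inv_mul_cancel_left₀ ht]

theorem IsMSequence.gramRank_add_finrank (hn : 3 ≤ n) (hs : IsMSequence n f s)
    (hK : Nat.card K = 2 ^ n) (hα : aeval α f = 0) (t : ℕ) :
    gramRank n s t + Module.finrank (ZMod 2) (reciprocalPairs n α (α ^ t)) = n := by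
  -- `Φ a` is the pair (numerator of the `t`-th shift, numerator). The second entry takes every
  -- value of degree `< n`, and the first is then forced by its value at `α`, so every reciprocal
  -- pair is attained.
  let Φ : (Fin n → ZMod 2) →ₗ[ZMod 2] (ZMod 2)[X] × (ZMod 2)[X] :=
    (seqNum f ∘ₗ (seqShift ^ t) ∘ₗ shiftComb n s).prod (seqNum f ∘ₗ shiftComb n s)
  have hmem (c : ℕ → ZMod 2) : seqNum f c ∈ degreeLT (ZMod 2) n := by
    have := seqNum_mem_degreeLT (f := f) c
    rwa [hs.primitive.natDegree_eq] at this
  have hΦ : Function.Injective Φ := fun a b h =>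
    hs.seqNum_shiftComb_injective (congrArg Prod.snd h)
  have hker : LinearMap.ker
      (observabilityMatrix n s t * (observabilityMatrix n s t).transpose).mulVecLin =
      (reciprocalPairs n α (α ^ t)).comap Φ := by
    ext a
    rw [hs.mem_ker_gram_iff, ← hs.isReciprocalPair_iff hn hK hα, Submodule.mem_comap,
      mem_reciprocalPairs]
    exact ⟨fun h => ⟨hmem _, hmem _, h⟩, fun h => h.2.2⟩
  have hrange : reciprocalPairs n α (α ^ t) ≤ LinearMap.range Φ := by
    rintro ⟨q, p⟩ ⟨h1, h2, h3⟩
    obtain ⟨a, rfl⟩ := hs.exists_seqNum_shiftComb h2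
    refine ⟨a, Prod.ext ?_ rfl⟩
    have h0 := hs.primitive.root_ne_zero hα
    have h4 := aeval_seqNum hs.primitive.monic (hs.aeval_shiftComb a) h0 t
    rw [hα, zero_mul, zero_mul, add_zero] at h4
    have h5 : seqNum f ((seqShift ^ t) (shiftComb n s a)) - q = 0 := by
      refine hs.primitive.eq_zero_of_aeval_eq_zero hα ?_ ?_
      · have h6 := sub_mem (hmem ((seqShift ^ t) (shiftComb n s a))) h1
        exact (mem_degreeLT_iff_natDegree_lt (by omega)).1 h6
      · rw [map_sub, h3.aeval_eq, h4]
        simp [h0]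
    exact sub_eq_zero.1 h5
  have hfr : Module.finrank (ZMod 2) ((reciprocalPairs n α (α ^ t)).comap Φ) =
      Module.finrank (ZMod 2) (reciprocalPairs n α (α ^ t)) := by
    rw [(Submodule.equivMapOfInjective Φ hΦ _).finrank_eq, Submodule.map_comap_eq_of_le hrange]
  have := LinearMap.finrank_range_add_finrank_ker
    (observabilityMatrix n s t * (observabilityMatrix n s t).transpose).mulVecLin
  rw [hker, hfr, Module.finrank_fin_fun] at this
  exact this

end GramKernel

/-! ### Values and local minima of the rank function -/

section RankFunction

variable {n : ℕ} {f : (ZMod 2)[X]} {s : ℕ → ZMod 2} {K : Type*} [Field K] [Algebra (ZMod 2) K]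
  {α τ : K}

theorem IsCanonicalRep.natAbs_add_natDegree_lt {k : ℤ} {u : (ZMod 2)[X]}
    (h : IsCanonicalRep n α τ k u) : k.natAbs + u.natDegree < n := by
  have := h.abs_le
  rw [Int.abs_eq_natAbs] at this
  omega

theorem isCanonicalRep_of_natAbs_add_natDegree_lt {k : ℤ} {u : (ZMod 2)[X]}
    (hu : u ∈ canonicalPolys n) (hlt : k.natAbs + u.natDegree < n)
    (h : τ = α ^ k * (aeval α u.reverse / aeval α u)) : IsCanonicalRep n α τ k u :=
  ⟨hu, by rw [Int.abs_eq_natAbs]; omega, h⟩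

/-- The pairs are the multiples `(gQ, gP)` of the reduced fraction `z^k ũ/u = Q/P`. As `max (deg Q)
(deg P) = |k| + deg u`, the multiplier `g` ranges over degrees `< n - (|k| + deg u)`. -/
theorem IsCanonicalRep.finrank_reciprocalPairs (hn : 3 ≤ n) (hf : IsPrimitivePoly n f)
    (hK : Nat.card K = 2 ^ n) (hα : aeval α f = 0) {k : ℤ} {u : (ZMod 2)[X]}
    (h : IsCanonicalRep n α τ k u) :
    Module.finrank (ZMod 2) (reciprocalPairs n α τ) = n - (k.natAbs + u.natDegree) := by
  have hlt := h.natAbs_add_natDegree_lt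
  have hu0 := coeff_zero_ne_of_mem_canonicalPolys h.mem
  have hpair := isReciprocalPair_repNum_repDen hf hα h.mem h.eq
  have hcop := isCoprime_repNum_repDen (k := k) h.mem
  have hQd := natDegree_repNum (k := k) hu0
  have hPd := natDegree_repDen (k := k) hu0
  have hP0 : repDen k u ≠ 0 :=
    mul_ne_zero (pow_ne_zero _ X_ne_zero) (ne_zero_of_coeff_zero_ne hu0)
  have hQ0 : repNum k u ≠ 0 :=
    mul_ne_zero (pow_ne_zero _ X_ne_zero) (reverse_eq_zero.not.2 (ne_zero_of_coeff_zero_ne hu0))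
  have hn0 : 0 < n := by omega
  set m := n - (k.natAbs + u.natDegree) with hm
  have hm0 : 0 < m := by omega
  let ψ : degreeLT (ZMod 2) m →ₗ[ZMod 2] (ZMod 2)[X] × (ZMod 2)[X] :=
    ((LinearMap.mulRight (ZMod 2) (repNum k u)).prod (LinearMap.mulRight (ZMod 2) (repDen k u))) ∘ₗ
      (degreeLT (ZMod 2) m).subtype
  have hψ : Function.Injective ψ := fun g g' hg =>
    Subtype.ext (mul_right_cancel₀ hP0 (congrArg Prod.snd hg))
  have hrange : LinearMap.range ψ = reciprocalPairs n α τ := by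
    ext ⟨q, p⟩
    constructor
    · rintro ⟨⟨g, hg⟩, hgz⟩
      obtain ⟨rfl, rfl⟩ : g * repNum k u = q ∧ g * repDen k u = p :=
        ⟨congrArg Prod.fst hgz, congrArg Prod.snd hgz⟩
      rw [mem_degreeLT_iff_natDegree_lt hm0] at hg
      refine ⟨?_, ?_, ?_, ?_⟩
      · exact (mem_degreeLT_iff_natDegree_lt hn0).2 (natDegree_mul_le.trans_lt (by omega))
      · exact (mem_degreeLT_iff_natDegree_lt hn0).2 (natDegree_mul_le.trans_lt (by omega))
      · simp only [map_mul, hpair.aeval_eq]; ring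
      · simp only [map_mul, hpair.aeval_inv_eq]; ring
    · rintro ⟨h1, h2, h3⟩
      rw [mem_degreeLT_iff_natDegree_lt hn0] at h1 h2
      have key : q * repDen k u = p * repNum k u :=
        h3.cross_mul_eq hn hf hK hα hpair (by dsimp at *; omega) (by dsimp at *; omega)
      obtain ⟨g, rfl⟩ : repDen k u ∣ p :=
        hcop.symm.dvd_of_dvd_mul_right (key ▸ dvd_mul_left _ _)
      obtain rfl : q = g * repNum k u := mul_right_cancel₀ hP0 (by rw [key]; ring)
      suffices hg : g ∈ degreeLT (ZMod 2) m by
        refine ⟨⟨g, hg⟩, ?_⟩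
        change (g * repNum k u, g * repDen k u) = (g * repNum k u, repDen k u * g)
        rw [mul_comm g (repDen k u)]
      rw [mem_degreeLT_iff_natDegree_lt hm0]
      by_cases hg : g = 0
      · simpa [hg] using hm0
      · dsimp only at h1 h2
        rw [natDegree_mul hg hQ0] at h1
        rw [natDegree_mul hP0 hg] at h2
        omega
  rw [← hrange, LinearMap.finrank_range_of_inj hψ, (degreeLTEquiv (ZMod 2) m).finrank_eq,
    Module.finrank_fin_fun]

theorem gramRank_le (s : ℕ → ZMod 2) (t : ℕ) : gramRank n s t ≤ n :=
  (Matrix.rank_le_card_height _).trans_eq (Fintype.card_fin n)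

theorem IsMSequence.gramRank_eq_of_isCanonicalRep (hn : 3 ≤ n) (hs : IsMSequence n f s)
    (hK : Nat.card K = 2 ^ n) (hα : aeval α f = 0) {t : ℕ} {k : ℤ} {u : (ZMod 2)[X]}
    (h : IsCanonicalRep n α (α ^ t) k u) : gramRank n s t = k.natAbs + u.natDegree := by
  have h1 := hs.gramRank_add_finrank hn hK hα t
  rw [h.finrank_reciprocalPairs hn hs.primitive hK hα] at h1
  have := h.natAbs_add_natDegree_lt
  omega

theorem IsMSequence.gramRank_eq_of_not_isCanonicalRep (hn : 3 ≤ n) (hs : IsMSequence n f s)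
    (hK : Nat.card K = 2 ^ n) (hα : aeval α f = 0) {t : ℕ}
    (h : ¬ ∃ (k : ℤ) (u : (ZMod 2)[X]), IsCanonicalRep n α (α ^ t) k u) : gramRank n s t = n := by
  have h1 := hs.gramRank_add_finrank hn hK hα t
  have hn0 : 0 < n := by omega
  have : reciprocalPairs n α (α ^ t) = ⊥ := by
    rw [eq_bot_iff]
    rintro ⟨q, p⟩ ⟨h1, h2, h3⟩
    rw [mem_degreeLT_iff_natDegree_lt hn0] at h1 h2
    by_cases hp : p = 0
    · subst hp
      have hq : q = 0 := hs.primitive.eq_zero_of_aeval_eq_zero hα h1 (by simpa using h3.aeval_eq)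
      subst hq
      exact Submodule.zero_mem _
    · exact absurd (exists_canonicalRep_of_isReciprocalPair hn hs.primitive hK hα
        (pow_ne_zero _ (hs.primitive.root_ne_zero hα)) h3 h1 h2 hp) h
  rwa [this, finrank_bot, add_zero] at h1

/-- The rank formula persists one step past the canonical range: if `|k'| + deg u` reaches `n`,
uniqueness excludes any canonical representation, so the rank is `n`, as the formula predicts. -/
theorem IsMSequence.gramRank_eq_of_zpow (hn : 3 ≤ n) (hs : IsMSequence n f s)
    (hK : Nat.card K = 2 ^ n) (hα : aeval α f = 0) {t t' : ℕ} {k k' : ℤ} {u : (ZMod 2)[X]}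
    (h : IsCanonicalRep n α (α ^ t) k u) (hk : (k' - k).natAbs = 1)
    (ht : α ^ t' = α ^ (k' - k) * α ^ t) : gramRank n s t' = k'.natAbs + u.natDegree := by
  have h0 := hs.primitive.root_ne_zero hα
  have heq : α ^ t' = α ^ k' * (aeval α u.reverse / aeval α u) := by
    rw [ht, h.eq, ← mul_assoc, ← zpow_add₀ h0, sub_add_cancel]
  have hlt := h.natAbs_add_natDegree_lt
  by_cases hlt' : k'.natAbs + u.natDegree < n
  · exact hs.gramRank_eq_of_isCanonicalRep hn hK hα
      (isCanonicalRep_of_natAbs_add_natDegree_lt h.mem hlt' heq)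
  · rw [hs.gramRank_eq_of_not_isCanonicalRep hn hK hα]
    · omega
    · rintro ⟨k₁, u₁, h₁⟩
      have hlt₁ := h₁.natAbs_add_natDegree_lt
      obtain ⟨rfl, rfl⟩ := canonicalRep_unique hn hs.primitive hK hα h₁.mem h.mem h₁.eq heq
        (by omega)
      exact hlt' hlt₁

theorem IsPrimitivePoly.pow_cyclicIndex (hf : IsPrimitivePoly n f) (hα : aeval α f = 0)
    (t : ZMod (2 ^ n - 1)) : α ^ cyclicIndex n t = α ^ t.val := by
  rw [cyclicIndex]
  split_ifs with h
  · rw [h, pow_zero, ← hf.orderOf_eq hα, pow_orderOf_eq_one]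
  · rfl

theorem IsPrimitivePoly.pow_cyclicIndex_add_one (hn : 3 ≤ n) (hf : IsPrimitivePoly n f)
    (hα : aeval α f = 0) (t : ZMod (2 ^ n - 1)) :
    α ^ cyclicIndex n (t + 1) = α * α ^ cyclicIndex n t := by
  have h8 : 2 ^ 3 ≤ 2 ^ n := Nat.pow_le_pow_right (by norm_num) hn
  have : NeZero (2 ^ n - 1) := ⟨by omega⟩
  have : Fact (1 < 2 ^ n - 1) := ⟨by omega⟩
  rw [hf.pow_cyclicIndex hα, hf.pow_cyclicIndex hα, ZMod.val_add, ZMod.val_one,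
    ← pow_succ']
  have h := pow_mod_orderOf α (t.val + 1)
  rwa [hf.orderOf_eq hα] at h

theorem IsPrimitivePoly.pow_cyclicIndex_injective (hn : 3 ≤ n) (hf : IsPrimitivePoly n f)
    (hα : aeval α f = 0) : Function.Injective fun t : ZMod (2 ^ n - 1) => α ^ cyclicIndex n t := by
  have h8 : 2 ^ 3 ≤ 2 ^ n := Nat.pow_le_pow_right (by norm_num) hn
  have : NeZero (2 ^ n - 1) := ⟨by omega⟩
  intro t t' h
  simp only [hf.pow_cyclicIndex hα] at h
  refine ZMod.val_injective _ (pow_injOn_Iio_orderOf ?_ ?_ h) <;>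
    rw [Set.mem_Iio, hf.orderOf_eq hα] <;> exact ZMod.val_lt _

theorem IsPrimitivePoly.exists_pow_cyclicIndex (hn : 3 ≤ n) (hf : IsPrimitivePoly n f)
    (hK : Nat.card K = 2 ^ n) (hα : aeval α f = 0) {x : K} (hx : x ≠ 0) :
    ∃ t : ZMod (2 ^ n - 1), α ^ cyclicIndex n t = x := by
  have h8 : 2 ^ 3 ≤ 2 ^ n := Nat.pow_le_pow_right (by norm_num) hn
  have : NeZero (2 ^ n - 1) := ⟨by omega⟩
  have : Finite K := Nat.finite_of_card_ne_zero (by rw [hK]; positivity)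
  let g : ZMod (2 ^ n - 1) → Kˣ := fun t => Units.mk0 α (hf.root_ne_zero hα) ^ cyclicIndex n t
  have hg : Function.Bijective g := by
    rw [Nat.bijective_iff_injective_and_card]
    constructor
    · intro t t' h
      exact hf.pow_cyclicIndex_injective hn hα (by simpa [g] using congrArg Units.val h)
    · rw [Nat.card_zmod, Nat.card_units, hK]
  obtain ⟨t, ht⟩ := hg.2 (Units.mk0 x hx)
  exact ⟨t, by simpa [g] using congrArg Units.val ht⟩

theorem IsMSequence.mem_localMinima_iff (hn : 3 ≤ n) (hs : IsMSequence n f s)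
    (hK : Nat.card K = 2 ^ n) (hα : aeval α f = 0) {t : ZMod (2 ^ n - 1)} {k : ℤ}
    {u : (ZMod 2)[X]} (h : IsCanonicalRep n α (α ^ cyclicIndex n t) k u) :
    t ∈ localMinima n s ↔ k = 0 := by
  have h0 := hs.primitive.root_ne_zero hα
  have hr : rankFn n s t = _ := hs.gramRank_eq_of_isCanonicalRep hn hK hα h
  have hr1 : rankFn n s (t + 1) = (k + 1).natAbs + u.natDegree :=
    hs.gramRank_eq_of_zpow hn hK hα h (by simp) (by
      rw [hs.primitive.pow_cyclicIndex_add_one hn hα, add_sub_cancel_left, zpow_one])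
  have hr2 : rankFn n s (t - 1) = (k - 1).natAbs + u.natDegree :=
    hs.gramRank_eq_of_zpow hn hK hα h (by omega) (by
      have := hs.primitive.pow_cyclicIndex_add_one hn hα (t - 1)
      rw [sub_add_cancel] at this
      rw [this, sub_sub_cancel_left, zpow_neg_one, inv_mul_cancel_left₀ h0])
  rw [localMinima, Set.mem_ofPred_eq, hr, hr1, hr2]
  omega

/-- Without a representation the rank is already the maximal `n`, so it cannot increase at `t + 1`.
-/
theorem IsMSequence.exists_isCanonicalRep_of_mem (hn : 3 ≤ n) (hs : IsMSequence n f s)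
    (hK : Nat.card K = 2 ^ n) (hα : aeval α f = 0) {t : ZMod (2 ^ n - 1)}
    (ht : t ∈ localMinima n s) :
    ∃ (k : ℤ) (u : (ZMod 2)[X]), IsCanonicalRep n α (α ^ cyclicIndex n t) k u := by
  by_contra h
  have h1 : rankFn n s t = n := hs.gramRank_eq_of_not_isCanonicalRep hn hK hα h
  have h2 : rankFn n s (t + 1) ≤ n := gramRank_le _ _
  have h3 := ht.2
  omega

theorem IsMSequence.existsUnique_isCanonicalRep (hn : 3 ≤ n) (hs : IsMSequence n f s)
    (hK : Nat.card K = 2 ^ n) (hα : aeval α f = 0) {t : ZMod (2 ^ n - 1)}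
    (ht : t ∈ localMinima n s) :
    ∃! p : ℤ × (ZMod 2)[X], IsCanonicalRep n α (α ^ cyclicIndex n t) p.1 p.2 := by
  obtain ⟨k, u, h⟩ := hs.exists_isCanonicalRep_of_mem hn hK hα ht
  refine ⟨(k, u), h, ?_⟩
  rintro ⟨k', u'⟩ h'
  have h1 := h.natAbs_add_natDegree_lt
  have h2 := h'.natAbs_add_natDegree_lt
  obtain ⟨rfl, rfl⟩ := canonicalRep_unique hn hs.primitive hK hα h.mem h'.mem h.eq h'.eq
    (by simp only at h1 h2 ⊢; omega)
  rfl

theorem IsMSequence.existsUnique_mem_localMinima (hn : 3 ≤ n) (hs : IsMSequence n f s)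
    (hK : Nat.card K = 2 ^ n) (hα : aeval α f = 0) {u : (ZMod 2)[X]} (hu : u ∈ canonicalPolys n) :
    ∃! t : ZMod (2 ^ n - 1),
      t ∈ localMinima n s ∧ IsCanonicalRep n α (α ^ cyclicIndex n t) 0 u := by
  have h1 := hs.primitive.aeval_ne_zero_of_mem hα hu
  have h2 := hs.primitive.aeval_ne_zero_of_mem hα (reverse_mem_canonicalPolys hu)
  obtain ⟨t, ht⟩ := hs.primitive.exists_pow_cyclicIndex hn hK hα (div_ne_zero h2 h1)
  have hrep : IsCanonicalRep n α (α ^ cyclicIndex n t) 0 u :=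
    isCanonicalRep_of_natAbs_add_natDegree_lt hu (by simpa using hu.1)
      (by rw [ht, zpow_zero, one_mul])
  refine ⟨t, ⟨(hs.mem_localMinima_iff hn hK hα hrep).2 rfl, hrep⟩, ?_⟩
  rintro t' ⟨-, h'⟩
  exact hs.primitive.pow_cyclicIndex_injective hn hα (h'.eq.trans hrep.eq.symm)

theorem IsMSequence.ncard_localMinima (hn : 3 ≤ n) (hs : IsMSequence n f s)
    (hK : Nat.card K = 2 ^ n) (hα : aeval α f = 0) :
    (localMinima n s).ncard = (canonicalPolys n).ncard := by
  symm
  choose! g hg huniq using fun u hu => hs.existsUnique_mem_localMinima hn hK hα (u := u) hu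
  refine Set.ncard_congr (fun u _ => g u) (fun u hu => (hg u hu).1) ?_ ?_
  · intro u u' hu hu' h
    have h1 := (hg u hu).2
    have h2 := (hg u' hu').2
    rw [h] at h1
    exact congrArg Prod.snd
      ((hs.existsUnique_isCanonicalRep hn hK hα (hg u' hu').1).unique (y₁ := (0, u))
        (y₂ := (0, u')) h1 h2)
  · intro t ht
    obtain ⟨k, u, h⟩ := hs.exists_isCanonicalRep_of_mem hn hK hα ht
    obtain rfl := (hs.mem_localMinima_iff hn hK hα h).1 ht
    exact ⟨u, h.mem, (huniq u h.mem t ⟨ht, h⟩).symm⟩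

end RankFunction

/-! ### Counting polynomials coprime to their reciprocal -/

section Counting

/-- The polynomials of degree `d` over `𝔽₂` with constant term `1`. -/
def unitConstPolys (d : ℕ) : Set (ZMod 2)[X] := {u | u.natDegree = d ∧ u.coeff 0 = 1}

/-- The self-reciprocal polynomials of degree `d` over `𝔽₂` with constant term `1`. -/
def selfReciprocalPolys (d : ℕ) : Set (ZMod 2)[X] := {u | u ∈ unitConstPolys d ∧ u.reverse = u}

/-- The polynomials of degree `d` over `𝔽₂` with constant term `1` which are coprime to their
reciprocal. -/
def coprimeReversePolys (d : ℕ) : Set (ZMod 2)[X] :=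
  {u | u ∈ unitConstPolys d ∧ IsCoprime u u.reverse}

theorem coeff_natDegree_of_mem_unitConstPolys {d : ℕ} {u : (ZMod 2)[X]}
    (hu : u ∈ unitConstPolys d) : u.coeff d = 1 := by
  apply ZMod.eq_one_of_ne_zero_two
  rw [← hu.1, coeff_natDegree, leadingCoeff_ne_zero]
  exact ne_zero_of_coeff_zero_ne (hu.2 ▸ one_ne_zero)

theorem coeff_sum_range_monomial (d : ℕ) (c : ℕ → ZMod 2) (i : ℕ) :
    (∑ j ∈ Finset.range (d + 1), monomial j (c j)).coeff i = if i ≤ d then c i else 0 := by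
  simp [finsetSum_coeff, coeff_monomial]

theorem sum_range_monomial_mem_unitConstPolys {d : ℕ} {c : ℕ → ZMod 2} (h0 : c 0 = 1)
    (hd : c d = 1) : ∑ j ∈ Finset.range (d + 1), monomial j (c j) ∈ unitConstPolys d := by
  constructor
  · refine natDegree_eq_of_le_of_coeff_ne_zero ?_ ?_
    · rw [natDegree_le_iff_coeff_eq_zero]
      intro i hi
      rw [coeff_sum_range_monomial, if_neg (by omega)]
    · rw [coeff_sum_range_monomial, if_pos le_rfl, hd]
      exact one_ne_zero
  · rw [coeff_sum_range_monomial, if_pos (Nat.zero_le _), h0]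

theorem finite_unitConstPolys (d : ℕ) : (unitConstPolys d).Finite := by
  rw [← Set.finite_coe_iff]
  refine Finite.of_injective
    (fun (u : unitConstPolys d) (i : Fin (d + 1)) => (u : (ZMod 2)[X]).coeff i) ?_
  rintro ⟨u, hu⟩ ⟨v, hv⟩ h
  refine Subtype.ext (ext fun i => ?_)
  by_cases hi : i < d + 1
  · exact congrFun h ⟨i, hi⟩
  · rw [coeff_eq_zero_of_natDegree_lt (by rw [hu.1]; omega),
      coeff_eq_zero_of_natDegree_lt (by rw [hv.1]; omega)]

theorem card_unitConstPolys_zero : Nat.card (unitConstPolys 0) = 1 := by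
  have : unitConstPolys 0 = {1} := by
    ext u
    constructor
    · rintro ⟨h1, h2⟩
      rw [eq_C_of_natDegree_eq_zero h1, h2]; simp
    · rintro rfl
      exact ⟨natDegree_one, coeff_one_zero⟩
  rw [this]; simp

theorem card_unitConstPolys_succ (m : ℕ) : Nat.card (unitConstPolys (m + 1)) = 2 ^ m := by
  have hbij : Function.Bijective
      fun (u : unitConstPolys (m + 1)) (i : Fin m) => (u : (ZMod 2)[X]).coeff (i + 1) := by
    constructor
    · rintro ⟨u, hu⟩ ⟨v, hv⟩ h
      refine Subtype.ext (ext fun i => ?_)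
      rcases Nat.eq_zero_or_pos i with rfl | h0
      · rw [hu.2, hv.2]
      rcases lt_trichotomy i (m + 1) with hi | rfl | hi
      · have := congrFun h ⟨i - 1, by omega⟩
        simpa only [Nat.sub_add_cancel h0] using this
      · rw [coeff_natDegree_of_mem_unitConstPolys hu, coeff_natDegree_of_mem_unitConstPolys hv]
      · rw [coeff_eq_zero_of_natDegree_lt (by rw [hu.1]; omega),
          coeff_eq_zero_of_natDegree_lt (by rw [hv.1]; omega)]
    · intro w
      -- The default `1` supplies the forced coefficients at `0` and `m + 1`.
      let c : ℕ → ZMod 2 := fun i => if h : 0 < i ∧ i - 1 < m then w ⟨i - 1, h.2⟩ else 1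
      refine ⟨⟨_, sum_range_monomial_mem_unitConstPolys (c := c) (by simp [c]) (by simp [c])⟩, ?_⟩
      ext i
      have := i.2
      dsimp only
      rw [coeff_sum_range_monomial, if_pos (by omega)]
      simp [c]
  rw [Nat.card_congr (Equiv.ofBijective _ hbij)]
  simp

theorem card_selfReciprocalPolys (d : ℕ) : Nat.card (selfReciprocalPolys d) = 2 ^ (d / 2) := by
  have hsymm {u : (ZMod 2)[X]} (hu : u ∈ selfReciprocalPolys d) {i : ℕ} (hi : i ≤ d) :
      u.coeff i = u.coeff (d - i) := by
    conv_lhs => rw [← hu.2]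
    rw [coeff_reverse, hu.1.1, revAt_le hi]
  have hbij : Function.Bijective
      fun (u : selfReciprocalPolys d) (i : Fin (d / 2)) => (u : (ZMod 2)[X]).coeff (i + 1) := by
    constructor
    · rintro ⟨u, hu⟩ ⟨v, hv⟩ h
      have key (i : ℕ) (hi : i ≤ d / 2) : u.coeff i = v.coeff i := by
        rcases Nat.eq_zero_or_pos i with rfl | h0
        · rw [hu.1.2, hv.1.2]
        · have := congrFun h ⟨i - 1, by omega⟩
          simpa only [Nat.sub_add_cancel h0] using this
      refine Subtype.ext (ext fun i => ?_)
      by_cases hi : i ≤ d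
      · by_cases hi' : i ≤ d / 2
        · exact key i hi'
        · rw [hsymm hu hi, hsymm hv hi, key _ (by omega)]
      · rw [coeff_eq_zero_of_natDegree_lt (by rw [hu.1.1]; omega),
          coeff_eq_zero_of_natDegree_lt (by rw [hv.1.1]; omega)]
    · intro w
      -- Folding `i` to `min i (d - i)` makes `c` palindromic; the default `1` covers both ends.
      let c : ℕ → ZMod 2 := fun i =>
        if h : 0 < min i (d - i) ∧ min i (d - i) - 1 < d / 2 then w ⟨min i (d - i) - 1, h.2⟩ else 1
      have hc (i : ℕ) (hi : i ≤ d) : c (d - i) = c i := by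
        have : min (d - i) (d - (d - i)) = min i (d - i) := by omega
        simp only [c, this]
      have hmem := sum_range_monomial_mem_unitConstPolys (d := d) (c := c) (by simp [c])
        (by simp [c])
      refine ⟨⟨_, hmem, ?_⟩, ?_⟩
      · ext i
        rw [coeff_reverse, hmem.1]
        by_cases hi : i ≤ d
        · rw [revAt_le hi, coeff_sum_range_monomial, coeff_sum_range_monomial, if_pos hi,
            if_pos (by omega), hc i hi]
        · rw [revAt_eq_self_of_lt (by omega)]
      · ext i
        have hi := i.2
        have : min ((i : ℕ) + 1) (d - (i + 1)) = i + 1 := by omega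
        dsimp only
        rw [coeff_sum_range_monomial, if_pos (by omega)]
        simp only [c, this]
        rw [dif_pos (by omega)]
        simp
  rw [Nat.card_congr (Equiv.ofBijective _ hbij)]
  simp

/-- Take `g = gcd(u, ũ)`. Reversing `u = gQ` and `ũ = gP` and using Bézout for `Q, P` gives `g̃ ∣
g`, hence `g̃ = g` and `P = Q̃`. -/
theorem exists_eq_mul_selfReciprocal {u : (ZMod 2)[X]} (hu : u.coeff 0 ≠ 0) :
    ∃ g v : (ZMod 2)[X], g.reverse = g ∧ IsCoprime v v.reverse ∧ u = g * v := by
  have hu0 := ne_zero_of_coeff_zero_ne hu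
  obtain ⟨g, Q, P, hg0, hcop, hQ, hP⟩ :=
    exists_eq_mul_isCoprime u (reverse_eq_zero.not.2 hu0)
  have hQ' : g.reverse * Q.reverse = g * P := by rw [← reverse_mul_of_domain, ← hQ, hP]
  have hP' : g.reverse * P.reverse = g * Q := by
    rw [← reverse_mul_of_domain, ← hP, reverse_reverse_of_coeff_zero_ne hu, hQ]
  have hgc : g.coeff 0 ≠ 0 := by
    rw [hQ, mul_coeff_zero] at hu
    exact left_ne_zero_of_mul hu
  obtain ⟨a, b, hab⟩ := hcop
  have h1 : g.reverse ∣ g := by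
    refine ⟨a * P.reverse + b * Q.reverse, ?_⟩
    linear_combination (-g) * hab - a * hP' - b * hQ'
  have h2 : g ∣ g.reverse := by
    have := reverse_dvd h1
    rwa [reverse_reverse_of_coeff_zero_ne hgc] at this
  have hg := eq_of_dvd_dvd_zmod_two h1 h2
  rw [hg] at hQ'
  refine ⟨g, Q, hg, ?_, hQ⟩
  rw [mul_left_cancel₀ hg0 hQ']
  exact ⟨a, b, hab⟩

/-- Uniqueness of the factorization: by Bézout `g` is a combination of `gv` and `gṽ`, both multiples
of `g'`. -/
theorem dvd_of_mul_selfReciprocal_eq {g g' v v' : (ZMod 2)[X]} (hg : g.reverse = g)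
    (hg' : g'.reverse = g') (hv : IsCoprime v v.reverse) (h : g * v = g' * v') : g' ∣ g := by
  have h' : g * v.reverse = g' * v'.reverse := by
    have := congrArg reverse h
    rwa [reverse_mul_of_domain, reverse_mul_of_domain, hg, hg'] at this
  obtain ⟨a, b, hab⟩ := hv
  exact ⟨a * v' + b * v'.reverse, by linear_combination (-g) * hab + a * h + b * h'⟩

theorem card_unitConstPolys_eq_sum (d : ℕ) : Nat.card (unitConstPolys d) =
    ∑ e ∈ Finset.range (d + 1), Nat.card (coprimeReversePolys e) * 2 ^ ((d - e) / 2) := by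
  let F : (Σ e : Fin (d + 1), coprimeReversePolys e × selfReciprocalPolys (d - e)) →
      unitConstPolys d := fun x => ⟨x.2.2 * x.2.1, by
    obtain ⟨⟨e, he⟩, ⟨v, hv⟩, ⟨g, hg⟩⟩ := x
    dsimp only at *
    refine ⟨?_, by rw [mul_coeff_zero, hg.1.2, hv.1.2, mul_one]⟩
    rw [natDegree_mul (ne_zero_of_coeff_zero_ne (hg.1.2 ▸ one_ne_zero))
      (ne_zero_of_coeff_zero_ne (hv.1.2 ▸ one_ne_zero)), hg.1.1, hv.1.1]
    omega⟩
  have hF : Function.Bijective F := by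
    constructor
    · rintro ⟨⟨e, he⟩, ⟨v, hv⟩, ⟨g, hg⟩⟩ ⟨⟨e', he'⟩, ⟨v', hv'⟩, ⟨g', hg'⟩⟩ h
      have h : g * v = g' * v' := congrArg Subtype.val h
      obtain rfl : g = g' := eq_of_dvd_dvd_zmod_two
        (dvd_of_mul_selfReciprocal_eq hg'.2 hg.2 hv'.2 h.symm)
        (dvd_of_mul_selfReciprocal_eq hg.2 hg'.2 hv.2 h)
      obtain rfl : v = v' :=
        mul_left_cancel₀ (ne_zero_of_coeff_zero_ne (hg.1.2 ▸ one_ne_zero)) h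
      obtain rfl : e = e' := hv.1.1.symm.trans hv'.1.1
      rfl
    · rintro ⟨u, hu⟩
      obtain ⟨g, v, hg, hv, rfl⟩ := exists_eq_mul_selfReciprocal (hu.2 ▸ one_ne_zero)
      have h0 : g.coeff 0 ≠ 0 ∧ v.coeff 0 ≠ 0 := by
        have := hu.2 ▸ (one_ne_zero : (1 : ZMod 2) ≠ 0)
        rw [mul_coeff_zero] at this
        exact mul_ne_zero_iff.1 this
      have hd := hu.1
      rw [natDegree_mul (ne_zero_of_coeff_zero_ne h0.1) (ne_zero_of_coeff_zero_ne h0.2)] at hd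
      exact ⟨⟨⟨v.natDegree, by omega⟩,
        ⟨v, ⟨rfl, ZMod.eq_one_of_ne_zero_two h0.2⟩, hv⟩,
        ⟨g, ⟨by dsimp only; omega, ZMod.eq_one_of_ne_zero_two h0.1⟩, hg⟩⟩, rfl⟩
  have (e : ℕ) : Finite (coprimeReversePolys e) :=
    ((finite_unitConstPolys e).subset fun _ h => h.1).to_subtype
  have (e : ℕ) : Finite (selfReciprocalPolys e) :=
    ((finite_unitConstPolys e).subset fun _ h => h.1).to_subtype
  rw [← Nat.card_congr (Equiv.ofBijective F hF), Nat.card_sigma, Finset.sum_range]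
  simp only [Nat.card_prod, card_selfReciprocalPolys]

theorem ncard_canonicalPolys_eq_sum (n : ℕ) :
    (canonicalPolys n).ncard = ∑ d ∈ Finset.range n, Nat.card (coprimeReversePolys d) := by
  have (e : ℕ) : Finite (coprimeReversePolys e) :=
    ((finite_unitConstPolys e).subset fun _ h => h.1).to_subtype
  let F : (Σ d : Fin n, coprimeReversePolys d) → canonicalPolys n := fun x =>
    ⟨x.2, by rw [x.2.2.1.1]; exact x.1.2, x.2.2.1.2, x.2.2.2⟩
  have hF : Function.Bijective F := by
    constructor
    · rintro ⟨⟨d, hd⟩, ⟨u, hu⟩⟩ ⟨⟨d', hd'⟩, ⟨u', hu'⟩⟩ h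
      obtain rfl : u = u' := congrArg Subtype.val h
      obtain rfl : d = d' := hu.1.1.symm.trans hu'.1.1
      rfl
    · rintro ⟨u, hu⟩
      exact ⟨⟨⟨u.natDegree, hu.1⟩, ⟨u, ⟨rfl, hu.2.1⟩, hu.2.2⟩⟩, rfl⟩
  rw [← Nat.card_coe_set_eq, ← Nat.card_congr (Equiv.ofBijective F hF), Nat.card_sigma,
    Finset.sum_range]

/-- Raising the degree by two doubles each weight `2^((d - e)/2)` with `e ≤ d`, so subtracting twice
the sum for `d` leaves only the two new terms, each of weight `1`. -/
theorem card_coprimeReversePolys_add (d : ℕ) :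
    Nat.card (coprimeReversePolys (d + 2)) + Nat.card (coprimeReversePolys (d + 1)) +
      2 * Nat.card (unitConstPolys d) = Nat.card (unitConstPolys (d + 2)) := by
  rw [card_unitConstPolys_eq_sum (d + 2), Finset.sum_range_succ, Finset.sum_range_succ,
    card_unitConstPolys_eq_sum d, Finset.mul_sum]
  have : ∑ e ∈ Finset.range (d + 1), Nat.card (coprimeReversePolys e) * 2 ^ ((d + 2 - e) / 2) =
      ∑ e ∈ Finset.range (d + 1), 2 * (Nat.card (coprimeReversePolys e) * 2 ^ ((d - e) / 2)) := by
    refine Finset.sum_congr rfl fun e he => ?_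
    rw [Finset.mem_range] at he
    rw [show (d + 2 - e) / 2 = (d - e) / 2 + 1 by omega, pow_succ]
    ring
  rw [this, show (d + 2 - (d + 1)) / 2 = 0 by omega, show (d + 2 - (d + 2)) / 2 = 0 by omega]
  ring

theorem card_coprimeReversePolys_zero : Nat.card (coprimeReversePolys 0) = 1 := by
  have := card_unitConstPolys_eq_sum 0
  rw [card_unitConstPolys_zero, Finset.sum_range_one] at this
  omega

theorem card_coprimeReversePolys_one : Nat.card (coprimeReversePolys 1) = 0 := by
  have := card_unitConstPolys_eq_sum 1
  rw [card_unitConstPolys_succ, Finset.sum_range_succ, Finset.sum_range_one,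
    card_coprimeReversePolys_zero] at this
  omega

/-- The closed form starts in degree `2`, because `card_unitConstPolys_zero` breaks the pattern
`2^(d-1)` and the recurrence is uniform only from `d = 1` on. -/
theorem card_coprimeReversePolys_add_two (m : ℕ) :
    (Nat.card (coprimeReversePolys (m + 2)) : ℚ) = 2 * (2 ^ m - (-1) ^ m) / 3 := by
  induction m with
  | zero =>
    have := card_coprimeReversePolys_add 0
    rw [card_unitConstPolys_zero, card_unitConstPolys_succ] at this
    have h : Nat.card (coprimeReversePolys (0 + 2)) = 0 := by omega
    simp [h]
  | succ m ih =>
    have := card_coprimeReversePolys_add (m + 1)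
    rw [card_unitConstPolys_succ, card_unitConstPolys_succ] at this
    have h : (Nat.card (coprimeReversePolys (m + 1 + 2)) : ℚ) +
        Nat.card (coprimeReversePolys (m + 2)) + 2 * 2 ^ m = 2 ^ (m + 2) := by exact_mod_cast this
    rw [ih] at h
    rw [pow_succ] at h ⊢
    linear_combination h

theorem ncard_canonicalPolys (m : ℕ) :
    ((canonicalPolys (m + 2)).ncard : ℚ) = (2 ^ (m + 1) - (-1) ^ (m + 1)) / 3 := by
  rw [ncard_canonicalPolys_eq_sum, Nat.cast_sum]
  induction m with
  | zero =>
    rw [zero_add, Finset.sum_range_succ, Finset.sum_range_one, card_coprimeReversePolys_zero,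
      card_coprimeReversePolys_one]
    norm_num
  | succ m ih =>
    rw [show m + 1 + 2 = (m + 2) + 1 by ring, Finset.sum_range_succ, ih,
      card_coprimeReversePolys_add_two]
    ring

end Counting

theorem IsPrimitivePoly.natCard_adjoinRoot {n : ℕ} {f : (ZMod 2)[X]} (hf : IsPrimitivePoly n f) :
    Nat.card (AdjoinRoot f) = 2 ^ n := by
  have : Module.Finite (ZMod 2) (AdjoinRoot f) := hf.monic.finite_adjoinRoot
  rw [Module.natCard_eq_pow_finrank (K := ZMod 2), Nat.card_zmod,
    (AdjoinRoot.powerBasis hf.irreducible.ne_zero).finrank, AdjoinRoot.powerBasis_dim,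
    hf.natDegree_eq]

/-- The number of local minima of `r_n`, and the correspondence of the local minima with the
canonical representations whose exponent `k` is zero. -/
theorem theorem4 (n : ℕ) (hn : 3 ≤ n) (f : (ZMod 2)[X]) (s : ℕ → ZMod 2)
    (hs : IsMSequence n f s) :
    ((localMinima n s).ncard : ℚ) = (2 ^ (n - 1) - (-1) ^ (n - 1)) / 3 ∧
    ∀ (K : Type*) [Field K] [Algebra (ZMod 2) K] (α : K),
      Nat.card K = 2 ^ n → aeval α f = 0 →
        -- every local minimum has a canonical representation, and only one
        (∀ t ∈ localMinima n s, ∃! p : ℤ × (ZMod 2)[X],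
          IsCanonicalRep n α (α ^ cyclicIndex n t) p.1 p.2) ∧
        -- among the classes with a canonical representation, the local minima are those with `k = 0`
        (∀ (t : ZMod (2 ^ n - 1)) (k : ℤ) (u : (ZMod 2)[X]),
          IsCanonicalRep n α (α ^ cyclicIndex n t) k u → (t ∈ localMinima n s ↔ k = 0)) ∧
        -- every admissible polynomial comes from exactly one local minimum
        (∀ u ∈ canonicalPolys n, ∃! t : ZMod (2 ^ n - 1),
          t ∈ localMinima n s ∧ IsCanonicalRep n α (α ^ cyclicIndex n t) 0 u) := by
  refine ⟨?_, fun K _ _ α hK hα => ⟨fun t ht => hs.existsUnique_isCanonicalRep hn hK hα ht,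
    fun t k u h => hs.mem_localMinima_iff hn hK hα h,
    fun u hu => hs.existsUnique_mem_localMinima hn hK hα hu⟩⟩
  have : Fact (Irreducible f) := ⟨hs.primitive.irreducible⟩
  -- The count does not mention a field, so `AdjoinRoot f` with its canonical root serves as
  -- `𝔽_{2^n}` and `α`.
  rw [hs.ncard_localMinima hn hs.primitive.natCard_adjoinRoot
    (by rw [aeval_def, AdjoinRoot.algebraMap_eq, AdjoinRoot.eval₂_root])]
  obtain ⟨m, rfl⟩ := Nat.exists_eq_add_of_le' hn
  exact ncard_canonicalPolys (m + 1)
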